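/- Let $n>2$ be an integer, let $G_n(s)=1+2^s+\dots+n^s=\sum_{m=1}^{n}m^s$ for $s\in\mathbb{C}$, and let $R_n=\overline{\{\operatorname{Re}s : s\in\mathbb{C},\ G_n(s)=0\}}$ be the closure in $\mathbb{R}$ of the set of real parts of the zeros of $G_n$. Let $s_0=\sigma_0+it_0$, with $\sigma_0,t_0\in\mathbb{R}$, be a simple zero of $G_n$. Then there exist real numbers $\varepsilon_1,\varepsilon_2\ge 0$ with $\varepsilon_1+\varepsilon_2>0$ such that $(\sigma_0-\varepsilon_1,\sigma_0+\varepsilon_2)\subset R_n$. Moreover, $\sigma_0$ is not an isolated point of $R_n$, that is, every neighbourhood of $\sigma_0$ contains a point of $R_n$ different from $\sigma_0$. -/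

import Mathlib

/-- The exponential polynomial `G_n(s) = 1 + 2^s + ⋯ + n^s`. -/
noncomputable def G (n : ℕ) (s : ℂ) : ℂ :=
  ∑ m ∈ Finset.Icc 1 n, (m : ℂ) ^ s

/-- `R_n`: the closure in `ℝ` of the set of real parts of the zeros of `G_n`. -/
def R (n : ℕ) : Set ℝ :=
  closure (Complex.re '' {s : ℂ | G n s = 0})

/-!
Let `p` be a prime with `p ≤ n < 2 * p`. Among `1, …, n` it divides only itself, so rotating the
term `p ^ s` of `G n s` alone by a phase `u` gives `∑ χ m * m ^ s` with `χ` completely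
multiplicative and unimodular: the `twist` with `χ p = u` and `χ q = 1` for primes `q ≠ p`.
Write `Φ s = 1 - G n s / p ^ s`; zeros of such rotated sums are the points with `‖Φ s‖ = 1`.

* Every zero `s` of a twisted sum has `s.re ∈ R n` (`re_mem_R_of_twisted_zero`). By Kronecker's
  theorem (`exists_natCast_cpow_near`) some vertical translate of `G n` is uniformly close to the
  twisted sum near `s`, hence vanishes near `s` by the quantitative open mapping theorem.
  Kronecker's theorem is proved following Bohr: if `f t = ∑ conj (χ m) * m ^ (i t)` stayed bounded
  by some `B < n`, then all coefficients of `f ^ N` would be at most `B ^ N` in absolute value,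
  although there are only polynomially many of them and they add up to `n ^ N`.
* At a simple zero `s₀` of `G n` one has `Φ s₀ = 1` and `Φ' s₀ ≠ 0`, so there is a continuous curve
  `γ` through `s₀` with `Φ (γ τ) = exp (i τ)` (`exists_curve`). The real parts along `γ` form an
  interval that contains `s₀.re` and lies in `R n`.
* This interval is not a single point. Otherwise `‖Φ‖ = 1` would hold on a sequence of points of the
  line `re = s₀.re` accumulating at `s₀`, hence on the whole line by analyticity, that is,
  `‖∑_{m ≠ p} m ^ s‖ = p ^ σ` on it. The square of the left side is an almost periodic function whose
  coefficient at the largest frequency `log L - log 1`, where `L > 1` is the largest index `m ≠ p`,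
  is not zero, so it is not constant (`not_frequently_norm_sum_eq`).
-/

open Complex Filter Topology

/-! ### Bohr coefficients of exponential sums -/

theorem tendsto_mean_exp (r : ℝ) :
    Tendsto (fun T : ℝ => (T : ℂ)⁻¹ * ∫ t in (0 : ℝ)..T, exp (I * r * t)) atTop
      (𝓝 (if r = 0 then 1 else 0)) := by
  split_ifs with hr
  · refine tendsto_const_nhds.congr' ?_
    filter_upwards [eventually_gt_atTop 0] with T hT
    have : (T : ℂ) ≠ 0 := by exact_mod_cast hT.ne'
    simp [hr, this]
  · have hc : I * (r : ℂ) ≠ 0 := by simp [hr]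
    rw [tendsto_zero_iff_norm_tendsto_zero]
    have hlim : Tendsto (fun T : ℝ => T⁻¹ * (2 / |r|)) atTop (𝓝 0) := by
      simpa using tendsto_inv_atTop_zero.mul_const (2 / |r|)
    refine squeeze_zero' (Eventually.of_forall fun _ => norm_nonneg _) ?_ hlim
    filter_upwards [eventually_gt_atTop 0] with T hT
    have key : ‖exp (I * r * T) - exp (I * r * (0 : ℝ))‖ ≤ 2 := by
      refine (norm_sub_le _ _).trans ?_
      have h (x : ℝ) : ‖exp (I * r * x)‖ = 1 := by
        rw [mul_assoc, ← ofReal_mul, norm_exp_I_mul_ofReal]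
      rw [h, h]; norm_num
    rw [integral_exp_mul_complex hc, norm_mul, norm_div, norm_inv, norm_real, norm_mul, norm_I,
      norm_real, one_mul, Real.norm_of_nonneg hT.le, Real.norm_eq_abs]
    gcongr

/-- Each Bohr coefficient of an exponential sum is bounded by any bound of the sum on the real line.
The frequencies `l j` need not be distinct; those equal to `μ` are collected. -/
theorem norm_bohr_coeff_le {ι : Type*} (J : Finset ι) (c : ι → ℂ) (l : ι → ℝ) (μ B : ℝ)
    (h : ∀ t : ℝ, ‖∑ j ∈ J, c j * exp (I * l j * t)‖ ≤ B) :
    ‖∑ j ∈ J with l j = μ, c j‖ ≤ B := by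
  have hlim : Tendsto (fun T : ℝ => ∑ j ∈ J, c j * ((T : ℂ)⁻¹ *
      ∫ t in (0 : ℝ)..T, exp (I * (l j - μ : ℝ) * t))) atTop
      (𝓝 (∑ j ∈ J, c j * (if l j - μ = 0 then 1 else 0))) :=
    tendsto_finsetSum _ fun j _ => (tendsto_mean_exp (l j - μ)).const_mul (c j)
  have hsum : ∑ j ∈ J, c j * (if l j - μ = 0 then (1 : ℂ) else 0) = ∑ j ∈ J with l j = μ, c j := by
    simp [Finset.sum_filter, sub_eq_zero]
  rw [hsum] at hlim
  refine le_of_tendsto hlim.norm ?_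
  filter_upwards [eventually_gt_atTop 0] with T hT
  have hint : ∑ j ∈ J, c j * ((T : ℂ)⁻¹ * ∫ t in (0 : ℝ)..T, exp (I * (l j - μ : ℝ) * t)) =
      (T : ℂ)⁻¹ * ∫ t in (0 : ℝ)..T, ∑ j ∈ J, c j * exp (I * (l j - μ : ℝ) * t) := by
    rw [intervalIntegral.integral_finsetSum, Finset.mul_sum]
    · refine Finset.sum_congr rfl fun j _ => ?_
      rw [intervalIntegral.integral_const_mul]; ring
    · intro j _
      exact Continuous.intervalIntegrable (by fun_prop) _ _
  have hB : ‖∫ t in (0 : ℝ)..T, ∑ j ∈ J, c j * exp (I * (l j - μ : ℝ) * t)‖ ≤ B * |T - 0| := by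
    refine intervalIntegral.norm_integral_le_of_norm_le_const fun t _ => ?_
    have : ∑ j ∈ J, c j * exp (I * (l j - μ : ℝ) * t) =
        (∑ j ∈ J, c j * exp (I * l j * t)) * exp (I * (-(μ * t) : ℝ)) := by
      rw [Finset.sum_mul]
      refine Finset.sum_congr rfl fun j _ => ?_
      rw [mul_assoc (c j), ← exp_add]
      push_cast; ring_nf
    rw [this, norm_mul, norm_exp_I_mul_ofReal, mul_one]
    exact h t
  rw [hint, norm_mul, norm_inv, norm_real, Real.norm_of_nonneg hT.le, inv_mul_le_iff₀ hT]
  simpa [abs_of_pos hT, mul_comm] using hB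

/-! ### Kronecker's theorem -/

/-- A sum of unit complex numbers, one of them `1`, is far from the trivial bound as soon as another
one is far from `1`. -/
theorem norm_sum_le_of_le_norm_one_sub {ι : Type*} [DecidableEq ι] {s : Finset ι} {z : ι → ℂ}
    {a b : ι}
    {δ : ℝ} (hδ : 0 < δ) (hz : ∀ m ∈ s, ‖z m‖ = 1) (ha : a ∈ s) (hza : z a = 1) (hb : b ∈ s)
    (hzb : δ ≤ ‖1 - z b‖) : ‖∑ m ∈ s, z m‖ ≤ s.card - 2 + √(4 - δ ^ 2) := by
  have hab : b ≠ a := by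
    rintro rfl
    simp [hza] at hzb
    linarith
  have hb' : b ∈ s.erase a := Finset.mem_erase.2 ⟨hab, hb⟩
  have h1 : ‖1 + z b‖ ≤ √(4 - δ ^ 2) := by
    apply Real.le_sqrt_of_sq_le
    have := parallelogram_law_with_norm ℝ 1 (z b)
    rw [hz b hb, norm_one] at this
    nlinarith
  have h2 : ‖∑ m ∈ (s.erase a).erase b, z m‖ ≤ s.card - 2 := by
    refine (norm_sum_le_of_le _ fun m hm =>
      (hz m (Finset.mem_of_mem_erase (Finset.mem_of_mem_erase hm))).le).trans ?_
    have e1 := Finset.card_erase_add_one hb'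
    have e2 := Finset.card_erase_add_one ha
    have : (((s.erase a).erase b).card : ℝ) + 2 = s.card := by norm_cast; omega
    simp only [Finset.sum_const, nsmul_eq_mul, mul_one]; linarith
  rw [← Finset.add_sum_erase s z ha, ← Finset.add_sum_erase _ z hb', hza, ← add_assoc]
  exact (norm_add_le _ _).trans (by linarith)

theorem natCast_cpow_I_mul {m : ℕ} (hm : m ≠ 0) (t : ℝ) :
    (m : ℂ) ^ (I * t) = exp (I * Real.log m * t) := by
  rw [cpow_def_of_ne_zero (by exact_mod_cast hm), natCast_log]
  ring_nf

/-- Expanding the `N`-th power by the multinomial theorem and reading off Bohr coefficients: each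
multinomial coefficient is at most `B ^ N`. Distinct exponent vectors `k` may give the same integer
`M k`, but multiplicativity of `χ` makes the terms that collide add up without cancellation. -/
theorem card_pow_le_of_norm_sum_le {n : ℕ} (χ : ℕ →*₀ ℂ)
    (hχ : ∀ m ≠ 0, ‖χ m‖ = 1) {B : ℝ}
    (hB : ∀ t : ℝ, ‖∑ m ∈ Finset.Icc 1 n, χ m * exp (I * Real.log m * t)‖ ≤ B) (N : ℕ) :
    (n : ℝ) ^ N ≤ ((N : ℝ) + 1) ^ n * B ^ N := by
  set s := Finset.Icc 1 n with hs
  have hs0 : ∀ m ∈ s, m ≠ 0 := fun m hm => by have := (Finset.mem_Icc.1 hm).1; omega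
  let M : (ℕ → ℕ) → ℕ := fun k => ∏ m ∈ s, m ^ k m
  have hM0 : ∀ k, M k ≠ 0 := fun k =>
    Finset.prod_ne_zero_iff.2 fun m hm => pow_ne_zero _ (hs0 m hm)
  have hexp : ∀ t : ℝ, (∑ m ∈ s, χ m * exp (I * Real.log m * t)) ^ N =
      ∑ k ∈ s.piAntidiag N, (Nat.multinomial s k * χ (M k)) * exp (I * Real.log (M k) * t) := by
    intro t
    rw [Finset.sum_pow_eq_sum_piAntidiag]
    refine Finset.sum_congr rfl fun k _ => ?_
    have hlog : Real.log (M k) = ∑ m ∈ s, k m * Real.log m := by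
      simp only [M, Nat.cast_prod, Nat.cast_pow]
      rw [Real.log_prod fun m hm => pow_ne_zero _ (by exact_mod_cast hs0 m hm)]
      simp
    simp only [mul_pow, Finset.prod_mul_distrib, M, map_prod, map_pow, mul_assoc]
    congr 2
    rw [show ((∏ m ∈ s, m ^ k m : ℕ)) = M k from rfl, hlog]
    simp only [← exp_nat_mul]
    rw [← exp_sum]
    push_cast
    simp only [Finset.mul_sum, Finset.sum_mul]
    congr 1
    exact Finset.sum_congr rfl fun m _ => by ring
  have hcoef : ∀ k ∈ s.piAntidiag N, (Nat.multinomial s k : ℝ) ≤ B ^ N := by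
    intro k hk
    have h := norm_bohr_coeff_le (s.piAntidiag N) (fun k => Nat.multinomial s k * χ (M k))
      (fun k => Real.log (M k)) (Real.log (M k)) (B ^ N) (fun t => by
        rw [← hexp t, norm_pow]; exact pow_le_pow_left₀ (norm_nonneg _) (hB t) N)
    have hval : ∑ j ∈ s.piAntidiag N with Real.log (M j) = Real.log (M k),
        (Nat.multinomial s j * χ (M j) : ℂ) =
        ((∑ j ∈ s.piAntidiag N with Real.log (M j) = Real.log (M k),
          (Nat.multinomial s j : ℝ) : ℝ) : ℂ) * χ (M k) := by
      push_cast
      rw [Finset.sum_mul]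
      refine Finset.sum_congr rfl fun j hj => ?_
      have := Real.log_injOn_pos (Set.mem_Ioi.2 (by exact_mod_cast (hM0 j).bot_lt))
        (Set.mem_Ioi.2 (by exact_mod_cast (hM0 k).bot_lt)) (Finset.mem_filter.1 hj).2
      rw [show M j = M k by exact_mod_cast this]
    rw [hval, norm_mul, hχ _ (hM0 k), mul_one, norm_real] at h
    refine le_trans ?_ ((le_abs_self _).trans h)
    exact Finset.single_le_sum (f := fun j => (Nat.multinomial s j : ℝ))
      (fun j _ => by positivity) (Finset.mem_filter.2 ⟨hk, rfl⟩)
  have hn' : (n : ℝ) ^ N = ∑ k ∈ s.piAntidiag N, (Nat.multinomial s k : ℝ) := by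
    have := Finset.sum_pow_eq_sum_piAntidiag s (fun _ => (1 : ℝ)) N
    simpa [hs] using this
  rw [hn']
  refine (Finset.sum_le_card_nsmul _ _ _ hcoef).trans ?_
  have hcard : (s.piAntidiag N).card ≤ (N + 1) ^ n := by
    have hpi : (s.pi fun _ => Finset.range (N + 1)).card = (N + 1) ^ n := by
      simp [Finset.card_pi, hs]
    rw [← hpi]
    refine Finset.card_le_card_of_injOn (fun k m _ => k m) (fun k hk => ?_) fun k hk k' hk' h => ?_
    · have hk := (Finset.mem_piAntidiag.1 hk).1
      refine Finset.mem_pi.2 fun m hm => Finset.mem_range.2 (Nat.lt_succ_of_le ?_)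
      rw [← hk]
      exact Finset.single_le_sum (fun _ _ => Nat.zero_le _) hm
    · have hk := (Finset.mem_piAntidiag.1 hk).2
      have hk' := (Finset.mem_piAntidiag.1 hk').2
      funext m
      by_cases hm : m ∈ s
      · exact congrFun (congrFun h m) hm
      · rw [not_imp_comm.1 (hk m) hm, not_imp_comm.1 (hk' m) hm]
  have hB0 : 0 ≤ B := (norm_nonneg _).trans (hB 0)
  rw [nsmul_eq_mul]
  gcongr
  exact_mod_cast hcard

theorem le_of_pow_le_poly_mul_pow {n : ℕ} (hn : n ≠ 0) {B : ℝ} (hB0 : 0 ≤ B)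
    (h : ∀ N : ℕ, (n : ℝ) ^ N ≤ ((N : ℝ) + 1) ^ n * B ^ N) : (n : ℝ) ≤ B := by
  by_contra! hlt
  have hn0 : (0 : ℝ) < n := by exact_mod_cast hn.bot_lt
  set r := B / n
  have hr : |r| < 1 := by
    rw [abs_of_nonneg (by positivity)]; exact (div_lt_one hn0).2 hlt
  have hlim := (tendsto_pow_const_mul_const_pow_of_abs_lt_one n hr).const_mul ((2 : ℝ) ^ n)
  rw [mul_zero] at hlim
  obtain ⟨N, hN, hN1⟩ := ((hlim.eventually_lt_const one_pos).and (eventually_ge_atTop 1)).exists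
  have hN1' : (1 : ℝ) ≤ N := by exact_mod_cast hN1
  have h1 : (n : ℝ) ^ N ≤ (2 * N : ℝ) ^ n * B ^ N :=
    (h N).trans (by gcongr; linarith)
  have h2 : B ^ N = r ^ N * (n : ℝ) ^ N := by
    rw [← mul_pow, div_mul_cancel₀ _ hn0.ne']
  rw [h2, mul_pow] at h1
  have : (0 : ℝ) < (n : ℝ) ^ N := by positivity
  nlinarith

/-- Kronecker's approximation theorem for the logarithms of the primes, in multiplicative form: the
unimodular completely multiplicative functions are pointwise limits of `m ↦ m ^ (i t)`. -/
theorem exists_natCast_cpow_near (n : ℕ) (χ : ℕ →*₀ ℂ) (hχ : ∀ m ≠ 0, ‖χ m‖ = 1)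
    {δ : ℝ} (hδ : 0 < δ) :
    ∃ t : ℝ, ∀ m ∈ Finset.Icc 1 n, ‖(m : ℂ) ^ (I * t) - χ m‖ < δ := by
  by_contra! hcon
  have hs0 : ∀ m ∈ Finset.Icc 1 n, m ≠ 0 := fun m hm => by have := (Finset.mem_Icc.1 hm).1; omega
  have hn : n ≠ 0 := by
    rintro rfl
    simpa using hcon 0
  -- Conjugation turns closeness of `m ^ (i t)` to `χ m` into closeness of a product to `1`.
  let χ' : ℕ →*₀ ℂ := (starRingEnd ℂ).toMonoidWithZeroHom.comp χ
  have hχ' : ∀ m ≠ 0, ‖χ' m‖ = 1 := fun m hm => by simpa [χ'] using hχ m hm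
  have hnorm : ∀ (m : ℕ) (t : ℝ), ‖exp (I * Real.log m * t)‖ = 1 := fun m t => by
    rw [mul_assoc, ← ofReal_mul, norm_exp_I_mul_ofReal]
  have hB : ∀ t : ℝ, ‖∑ m ∈ Finset.Icc 1 n, χ' m * exp (I * Real.log m * t)‖ ≤
      n - 2 + √(4 - δ ^ 2) := by
    intro t
    obtain ⟨m, hm, hle⟩ := hcon t
    have := norm_sum_le_of_le_norm_one_sub (s := Finset.Icc 1 n)
      (z := fun m => χ' m * exp (I * Real.log m * t)) (a := 1) (b := m) hδ
      (fun k hk => by rw [norm_mul, hχ' k (hs0 k hk), hnorm, one_mul])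
      (by simp; omega) (by simp) hm ?_
    · simpa using this
    · have h1 : 1 - χ' m * exp (I * Real.log m * t) =
          χ' m * (χ m - (m : ℂ) ^ (I * t)) := by
        rw [natCast_cpow_I_mul (hs0 m hm), mul_sub]
        have : χ' m * χ m = 1 := by
          simp [χ', mul_comm, mul_conj, normSq_eq_norm_sq, hχ m (hs0 m hm)]
        rw [this]
      rw [h1, norm_mul, hχ' m (hs0 m hm), one_mul, norm_sub_rev]
      exact hle
  have hle := le_of_pow_le_poly_mul_pow hn ((norm_nonneg _).trans (hB 0))
    (card_pow_le_of_norm_sum_le χ' hχ' hB)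
  have : √(4 - δ ^ 2) < 2 := by
    rw [Real.sqrt_lt' two_pos]; nlinarith
  linarith

/-! ### Zeros of twisted sums -/

theorem natCast_cpow_ofReal_add_I_mul {m : ℕ} (hm : m ≠ 0) (σ y : ℝ) :
    (m : ℂ) ^ ((σ : ℂ) + I * y) = ((m : ℝ) ^ σ : ℝ) * exp (I * Real.log m * y) := by
  rw [cpow_add _ _ (by exact_mod_cast hm), natCast_cpow_I_mul hm, ofReal_cpow (by positivity)]
  simp

theorem analyticOnNhd_sum_mul_natCast_cpow (S : Finset ℕ) (hS : ∀ m ∈ S, m ≠ 0) (c : ℕ → ℂ) :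
    AnalyticOnNhd ℂ (fun s : ℂ => ∑ m ∈ S, c m * (m : ℂ) ^ s) Set.univ := by
  refine DifferentiableOn.analyticOnNhd (Differentiable.differentiableOn ?_) isOpen_univ
  refine Differentiable.fun_sum fun m hm => ?_
  have : (m : ℂ) ≠ 0 := by exact_mod_cast hS m hm
  exact ((differentiable_id.const_cpow (Or.inl this))).const_mul _

theorem ne_zero_of_mem_Icc_one {n m : ℕ} (hm : m ∈ Finset.Icc 1 n) : m ≠ 0 := by
  have := (Finset.mem_Icc.1 hm).1; omega

theorem eventually_twisted_sum_ne_zero {n : ℕ} (hn : n ≠ 0) (χ : ℕ →*₀ ℂ) (s₁ : ℂ) :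
    ∀ᶠ z in 𝓝[≠] s₁, ∑ m ∈ Finset.Icc 1 n, χ m * (m : ℂ) ^ z ≠ 0 := by
  by_contra hcon
  have hF := analyticOnNhd_sum_mul_natCast_cpow (Finset.Icc 1 n)
    (fun _ => ne_zero_of_mem_Icc_one) χ
  have hzero := hF.eqOn_zero_of_preconnected_of_frequently_eq_zero isPreconnected_univ
    (Set.mem_univ s₁) (by simpa only [Filter.Frequently, not_not] using hcon)
  have h := norm_bohr_coeff_le (Finset.Icc 1 n) χ (fun m => Real.log m) 0 0 fun t => by
    have h0 := hzero (Set.mem_univ (I * t))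
    rw [norm_le_zero_iff, ← show ∑ m ∈ Finset.Icc 1 n, χ m * (m : ℂ) ^ (I * t) = 0 from h0]
    exact Finset.sum_congr rfl fun m hm => by
      rw [natCast_cpow_I_mul (ne_zero_of_mem_Icc_one hm)]
  have hfil : (Finset.Icc 1 n).filter (fun m : ℕ => Real.log m = 0) = {1} := by
    ext m
    simp only [Finset.mem_filter, Finset.mem_singleton]
    constructor
    · rintro ⟨hm, hlog⟩
      by_contra hne
      have : 1 < m := by have := ne_zero_of_mem_Icc_one hm; omega
      exact (Real.log_pos (by exact_mod_cast this)).ne' hlog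
    · rintro rfl
      simp; omega
  rw [hfil] at h
  simp at h
  linarith

/-- A zero of a twisted sum is a limit of zeros of vertical translates of `G n`, so its real part
lies in `R n`. -/
theorem re_mem_R_of_twisted_zero {n : ℕ} (hn : n ≠ 0) (χ : ℕ →*₀ ℂ) (hχ : ∀ m ≠ 0, ‖χ m‖ = 1)
    {s₁ : ℂ} (hs₁ : ∑ m ∈ Finset.Icc 1 n, χ m * (m : ℂ) ^ s₁ = 0) : s₁.re ∈ R n := by
  set F : ℂ → ℂ := fun z => ∑ m ∈ Finset.Icc 1 n, χ m * (m : ℂ) ^ z with hFdef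
  have hF := analyticOnNhd_sum_mul_natCast_cpow (Finset.Icc 1 n)
    (fun _ => ne_zero_of_mem_Icc_one) χ
  refine Metric.mem_closure_iff.2 fun r hr => ?_
  obtain ⟨ρ, hρ, hne⟩ := Metric.eventually_nhds_iff.1
    (eventually_nhdsWithin_iff.1 (eventually_twisted_sum_ne_zero hn χ s₁))
  set r' := min ρ r / 2 with hr'
  have hr'0 : 0 < r' := by positivity
  have hr'r : r' < r := by have := min_le_right ρ r; linarith
  have hr'ρ : r' < ρ := by have := min_le_left ρ r; linarith
  obtain ⟨z₀, hz₀, hmin⟩ := (isCompact_sphere s₁ r').exists_isMinOn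
    (NormedSpace.sphere_nonempty.2 hr'0.le)
    (hF.continuousOn.mono (Set.subset_univ _)).norm
  set ε := ‖F z₀‖
  have hε : 0 < ε := by
    refine norm_pos_iff.2 (hne ?_ ?_)
    · rw [Metric.mem_sphere.1 hz₀]; exact hr'ρ
    · rintro rfl
      simp at hz₀
      linarith
  obtain ⟨K, hK⟩ := (isCompact_closedBall s₁ r').exists_bound_of_continuousOn
    (f := fun z : ℂ => ∑ m ∈ Finset.Icc 1 n, ‖(m : ℂ) ^ z‖) <| by
      refine continuousOn_finsetSum _ fun m hm => ContinuousOn.norm ?_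
      have : (m : ℂ) ≠ 0 := by exact_mod_cast ne_zero_of_mem_Icc_one hm
      exact (continuous_id.const_cpow (Or.inl this)).continuousOn
  have hK0 : 0 ≤ K := (norm_nonneg _).trans (hK s₁ (Metric.mem_closedBall_self hr'0.le))
  -- With this tolerance, the translate `H` is within `ε / 4` of `F` on the closed ball.
  obtain ⟨t, ht⟩ := exists_natCast_cpow_near n χ hχ (δ := ε / (4 * (K + 1))) (by positivity)
  set H : ℂ → ℂ := fun z => ∑ m ∈ Finset.Icc 1 n, (m : ℂ) ^ (I * t) * (m : ℂ) ^ z with hHdef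
  have hH := analyticOnNhd_sum_mul_natCast_cpow (Finset.Icc 1 n)
    (fun _ => ne_zero_of_mem_Icc_one) (fun m : ℕ => (m : ℂ) ^ (I * t))
  have hHG : ∀ z, H z = G n (z + I * t) := fun z => Finset.sum_congr rfl fun m hm => by
    rw [add_comm, cpow_add _ _ (by exact_mod_cast ne_zero_of_mem_Icc_one hm)]
  have hclose : ∀ z ∈ Metric.closedBall s₁ r', ‖H z - F z‖ < ε / 4 := by
    intro z hz
    have hKz := (Real.le_norm_self _).trans (hK z hz)
    have h1 : ‖H z - F z‖ ≤ ∑ m ∈ Finset.Icc 1 n, ε / (4 * (K + 1)) * ‖(m : ℂ) ^ z‖ := by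
      rw [hHdef, hFdef]
      simp only [← Finset.sum_sub_distrib, ← sub_mul]
      refine norm_sum_le_of_le _ fun m hm => ?_
      rw [norm_mul]
      gcongr
      exact (ht m hm).le
    rw [← Finset.mul_sum] at h1
    calc _ ≤ _ := h1
      _ ≤ ε / (4 * (K + 1)) * K := by gcongr
      _ < ε / (4 * (K + 1)) * (K + 1) := by gcongr; linarith
      _ = ε / 4 := by field_simp
  have hs₁b := hclose s₁ (Metric.mem_closedBall_self hr'0.le)
  rw [show F s₁ = 0 from hs₁, sub_zero] at hs₁b
  have hsphere : ∀ z ∈ Metric.sphere s₁ r', ε / 2 ≤ ‖H z - H s₁‖ := by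
    intro z hz
    have h1 : ε ≤ ‖F z‖ := hmin hz
    have h2 := hclose z (Metric.sphere_subset_closedBall hz)
    have h3 : ‖F z‖ ≤ ‖H z - H s₁‖ + ‖H s₁‖ + ‖H z - F z‖ := by
      calc ‖F z‖ = ‖(H z - H s₁) + H s₁ - (H z - F z)‖ := by congr 1; ring
        _ ≤ _ := (norm_sub_le _ _).trans (by gcongr; exact norm_add_le _ _)
    linarith
  have hfreq : ∃ᶠ z in 𝓝 s₁, H z ≠ H s₁ := by
    intro hev
    have hev' : H =ᶠ[𝓝 s₁] fun _ => H s₁ := by simpa [Filter.EventuallyEq] using hev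
    have heq := hH.eqOn_of_preconnected_of_eventuallyEq analyticOnNhd_const isPreconnected_univ
      (Set.mem_univ s₁) hev'
    have h1 := hsphere z₀ hz₀
    rw [show H z₀ = H s₁ from heq (Set.mem_univ z₀)] at h1
    simp at h1
    linarith
  have hdiff : DiffContOnCl ℂ H (Metric.ball s₁ r') :=
    (differentiableOn_univ.1 hH.differentiableOn).diffContOnCl
  obtain ⟨z, hz, hz0⟩ := hdiff.ball_subset_image_closedBall hr'0 hsphere hfreq
    (show (0 : ℂ) ∈ Metric.ball (H s₁) (ε / 2 / 2) by
      rw [Metric.mem_ball, dist_zero_left]; linarith)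
  refine ⟨z.re, ⟨z + I * t, ?_, by simp⟩, ?_⟩
  · rw [Set.mem_ofPred_eq, ← hHG, hz0]
  · rw [dist_comm, Real.dist_eq, ← sub_re]
    exact ((abs_re_le_norm _).trans (mem_closedBall_iff_norm.1 hz)).trans_lt hr'r

/-- The completely multiplicative function with value `u` at the prime `p` and `1` at the other
primes. The multiplicity of `p` in `m` is `m.factorization p`, whose value at `m = 0` is `0`, hence
the separate clause there. -/
noncomputable def twist (p : ℕ) (u : ℂ) : ℕ →*₀ ℂ where
  toFun m := if m = 0 then 0 else u ^ m.factorization p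
  map_zero' := by simp
  map_one' := by simp
  map_mul' a b := by
    by_cases ha : a = 0
    · simp [ha]
    by_cases hb : b = 0
    · simp [hb]
    simp [ha, hb, Nat.factorization_mul, pow_add]

theorem norm_twist (p : ℕ) {u : ℂ} (hu : ‖u‖ = 1) {m : ℕ} (hm : m ≠ 0) :
    ‖twist p u m‖ = 1 := by
  simp [twist, hm, hu]

theorem twist_self {p : ℕ} (hp : p.Prime) (u : ℂ) : twist p u p = u := by
  simp [twist, hp.ne_zero, hp.factorization_self]

theorem twist_of_lt_two_mul {p : ℕ} (u : ℂ) {m : ℕ} (hm : m ≠ 0) (hmp : m ≠ p)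
    (hlt : m < 2 * p) : twist p u m = 1 := by
  have : ¬ p ∣ m := by
    rintro ⟨k, rfl⟩
    have h1 : k < 2 := by
      by_contra! h
      nlinarith
    interval_cases k <;> simp at hm hmp
  simp [twist, hm, Nat.factorization_eq_zero_of_not_dvd this]

theorem re_mem_R_of_norm_eq_one {n p : ℕ} (hp : p.Prime) (hpn : p ≤ n) (hnp : n < 2 * p) {s : ℂ}
    (hs : ‖1 - G n s / (p : ℂ) ^ s‖ = 1) : s.re ∈ R n := by
  have hp0 : (p : ℂ) ^ s ≠ 0 := by simp [cpow_eq_zero_iff, hp.ne_zero]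
  have hpmem : p ∈ Finset.Icc 1 n := Finset.mem_Icc.2 ⟨hp.one_lt.le, hpn⟩
  refine re_mem_R_of_twisted_zero (by have := hp.pos; omega) (twist p (1 - G n s / (p : ℂ) ^ s))
    (fun m hm => norm_twist p hs hm) ?_
  have hG : G n s = (p : ℂ) ^ s + ∑ m ∈ (Finset.Icc 1 n).erase p, (m : ℂ) ^ s :=
    (Finset.add_sum_erase _ _ hpmem).symm
  rw [← Finset.add_sum_erase _ _ hpmem, twist_self hp]
  have : ∑ m ∈ (Finset.Icc 1 n).erase p,
      twist p (1 - G n s / (p : ℂ) ^ s) m * (m : ℂ) ^ s =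
      ∑ m ∈ (Finset.Icc 1 n).erase p, (m : ℂ) ^ s := by
    refine Finset.sum_congr rfl fun m hm => ?_
    obtain ⟨hmp, hm⟩ := Finset.mem_erase.1 hm
    rw [twist_of_lt_two_mul _ (ne_zero_of_mem_Icc_one hm) hmp
      ((Finset.mem_Icc.1 hm).2.trans_lt hnp), one_mul]
  rw [this, sub_mul, div_mul_cancel₀ _ hp0, hG]
  ring

/-! ### Sums of constant modulus on a vertical line -/

/-- On a vertical line, the modulus of `∑ m ∈ S, m ^ s` does not agree with that of a single power
`p ^ s` at points accumulating somewhere: the squared modulus is an exponential sum in the ordinate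
with nonzero coefficient at the frequency `log L`, `L` being the largest element of `S`. -/
theorem not_frequently_norm_sum_eq {S : Finset ℕ} {p L : ℕ} (hS : ∀ m ∈ S, m ≠ 0)
    (h1 : 1 ∈ S) (hp : p ∉ S) (hp0 : p ≠ 0) (hL : L ∈ S) (hL1 : 1 < L) (hmax : ∀ m ∈ S, m ≤ L)
    (σ t₀ : ℝ) :
    ¬ ∃ᶠ y : ℝ in 𝓝[≠] t₀,
      ‖∑ m ∈ S, (m : ℂ) ^ ((σ : ℂ) + I * y)‖ = ‖(p : ℂ) ^ ((σ : ℂ) + I * y)‖ := by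
  intro hfreq
  -- The extra index `(p, p)` carries the constant term `-p ^ (2 * σ)`, of frequency `0`;
  -- it is not in `S ×ˢ S` because `p ∉ S`.
  let c : ℕ × ℕ → ℂ := fun x =>
    if x = (p, p) then -((p : ℝ) ^ σ * (p : ℝ) ^ σ : ℝ)
    else ((x.1 : ℝ) ^ σ * (x.2 : ℝ) ^ σ : ℝ)
  let l : ℕ × ℕ → ℝ := fun x => Real.log x.1 - Real.log x.2
  let J : Finset (ℕ × ℕ) := insert (p, p) (S ×ˢ S)
  let Q : ℝ → ℂ := fun y => ∑ x ∈ J, c x * exp (I * l x * y)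
  have hQ : ∀ y : ℝ, Q y = ((‖∑ m ∈ S, (m : ℂ) ^ ((σ : ℂ) + I * y)‖ ^ 2 -
      ‖(p : ℂ) ^ ((σ : ℂ) + I * y)‖ ^ 2 : ℝ) : ℂ) := by
    intro y
    have hpS : (p, p) ∉ S ×ˢ S := by simp [hp]
    have hpn : ‖(p : ℂ) ^ ((σ : ℂ) + I * y)‖ = (p : ℝ) ^ σ := by
      rw [norm_natCast_cpow_of_pos hp0.bot_lt]; simp
    have hpp : c (p, p) * exp (I * l (p, p) * y) = -(((p : ℝ) ^ σ) ^ 2 : ℝ) := by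
      simp [c, l, sq]
    have hSS : ∑ x ∈ S ×ˢ S, c x * exp (I * l x * y) =
        ((‖∑ m ∈ S, (m : ℂ) ^ ((σ : ℂ) + I * y)‖ ^ 2 : ℝ) : ℂ) := by
      rw [ofReal_pow, ← mul_conj', map_sum, Finset.sum_mul_sum, ← Finset.sum_product']
      refine Finset.sum_congr rfl fun ⟨a, b⟩ hx => ?_
      obtain ⟨ha, hb⟩ := Finset.mem_product.1 hx
      have hne : ((a, b) : ℕ × ℕ) ≠ (p, p) := fun h => hpS (h ▸ hx)
      have hexp : exp (I * l (a, b) * y) =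
          exp (I * Real.log a * y) * exp (-(I * Real.log b * y)) := by
        rw [← exp_add]; simp only [l]; push_cast; ring_nf
      simp only [c, if_neg hne]
      rw [natCast_cpow_ofReal_add_I_mul (hS a ha), natCast_cpow_ofReal_add_I_mul (hS b hb),
        map_mul, conj_ofReal, ← exp_conj, hexp]
      simp only [map_mul, conj_I, conj_ofReal, neg_mul, ofReal_mul]
      ring
    simp only [Q, J]
    rw [Finset.sum_insert hpS, hpn, hSS, hpp]
    push_cast
    ring
  have hQan : AnalyticOnNhd ℝ Q Set.univ := by
    intro y _
    have hof : AnalyticAt ℝ (fun y : ℝ => (y : ℂ)) y := ofRealCLM.analyticAt y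
    have hC : Differentiable ℂ fun z : ℂ => ∑ x ∈ J, c x * exp (I * l x * z) := by fun_prop
    exact (hC.analyticAt (y : ℂ)).restrictScalars.comp hof
  have hQ0 := hQan.eqOn_zero_of_preconnected_of_frequently_eq_zero isPreconnected_univ
    (Set.mem_univ t₀) (hfreq.mono fun y hy => by rw [hQ, hy, sub_self, ofReal_zero])
  have hcoef := norm_bohr_coeff_le J c l (Real.log L) 0 fun t => by
    rw [norm_le_zero_iff]; exact hQ0 (Set.mem_univ t)
  have hfil : J.filter (fun x => l x = Real.log L) = {(L, 1)} := by
    ext ⟨a, b⟩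
    simp only [J, l, Finset.mem_filter, Finset.mem_insert, Finset.mem_product,
      Finset.mem_singleton, Prod.mk.injEq]
    have hLlog : 0 < Real.log L := Real.log_pos (by exact_mod_cast hL1)
    constructor
    · rintro ⟨⟨rfl, rfl⟩ | ⟨ha, hb⟩, hl⟩
      · simp at hl; grind
      · have ha0 : (a : ℝ) ≠ 0 := by exact_mod_cast hS a ha
        have hb0 : (b : ℝ) ≠ 0 := by exact_mod_cast hS b hb
        have hle : Real.log a ≤ Real.log L :=
          Real.log_le_log (by positivity) (by exact_mod_cast hmax a ha)
        have hb1 : (1 : ℝ) ≤ b := by exact_mod_cast (hS b hb).bot_lt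
        have hb' : Real.log b = 0 := le_antisymm (by linarith) (Real.log_nonneg hb1)
        have hbone : (b : ℝ) = 1 := by
          refine Real.eq_one_of_pos_of_log_eq_zero (by positivity) hb'
        have haL : (a : ℝ) = L := Real.log_injOn_pos (Set.mem_Ioi.2 (by positivity))
          (Set.mem_Ioi.2 (by positivity)) (by linarith)
        exact ⟨by exact_mod_cast haL, by exact_mod_cast hbone⟩
    · rintro ⟨rfl, rfl⟩
      exact ⟨Or.inr ⟨hL, h1⟩, by simp⟩
  rw [hfil] at hcoef
  have hne : ((L, 1) : ℕ × ℕ) ≠ (p, p) := by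
    intro h
    simp only [Prod.mk.injEq] at h
    omega
  have hLpos : 0 < (L : ℝ) ^ σ := by positivity
  rw [Finset.sum_singleton] at hcoef
  simp only [c, if_neg hne, norm_real] at hcoef
  rw [Nat.cast_one, Real.one_rpow, mul_one, Real.norm_of_nonneg hLpos.le] at hcoef
  exact hLpos.not_ge hcoef

theorem not_frequently_norm_eq_one {n p : ℕ} (hn : 2 < n) (hp : p.Prime) (hpn : p ≤ n) (σ t₀ : ℝ) :
    ¬ ∃ᶠ y : ℝ in 𝓝[≠] t₀,
      ‖1 - G n ((σ : ℂ) + I * y) / (p : ℂ) ^ ((σ : ℂ) + I * y)‖ = 1 := by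
  have hpmem : p ∈ Finset.Icc 1 n := Finset.mem_Icc.2 ⟨hp.one_lt.le, hpn⟩
  have hp1 := hp.one_lt
  have key := not_frequently_norm_sum_eq (S := (Finset.Icc 1 n).erase p) (p := p)
    (L := if p = n then n - 1 else n)
    (fun m hm => ne_zero_of_mem_Icc_one (Finset.mem_of_mem_erase hm))
    (by simp; omega) (by simp) hp.ne_zero (by simp; split_ifs <;> omega)
    (by split_ifs <;> omega)
    (fun m hm => by simp at hm; split_ifs <;> omega) σ t₀
  refine fun h => key (h.mono fun y hy => ?_)
  set s : ℂ := (σ : ℂ) + I * y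
  have hp0 : (p : ℂ) ^ s ≠ 0 := by simp [cpow_eq_zero_iff, hp.ne_zero]
  have hG : G n s = (p : ℂ) ^ s + ∑ m ∈ (Finset.Icc 1 n).erase p, (m : ℂ) ^ s :=
    (Finset.add_sum_erase _ _ hpmem).symm
  rw [hG, add_div, div_self hp0, sub_add_cancel_left, norm_neg, norm_div,
    div_eq_one_iff_eq (norm_ne_zero_iff.2 hp0)] at hy
  exact hy

/-! ### The curve of zeros through a simple zero -/

theorem deriv_ne_zero_of_simple_zero {g q : ℂ → ℂ} {s₀ : ℂ} (hg : AnalyticAt ℂ g s₀)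
    (hq : AnalyticAt ℂ q s₀) (hq0 : q s₀ ≠ 0) (h : analyticOrderAt g s₀ = 1) :
    deriv (fun s => 1 - g s / q s) s₀ ≠ 0 := by
  have hg0 : g s₀ = 0 := by
    by_contra hne
    rw [hg.analyticOrderAt_eq_zero.2 hne] at h
    simp at h
  have hg' : deriv g s₀ ≠ 0 := by
    have h1 := hg.analyticOrderAt_deriv_add_one
    simp only [hg0, sub_zero] at h1
    have h2 : analyticOrderAt (deriv g) s₀ = 0 := by
      rw [h] at h1
      exact (ENat.add_left_injective_of_ne_top ENat.one_ne_top) (by simpa using h1)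
    exact hg.deriv.analyticOrderAt_eq_zero.1 h2
  rw [deriv_const_sub, deriv_fun_div hg.differentiableAt hq.differentiableAt hq0, hg0]
  simp [hg', hq0]

theorem exists_Ioo_subset {A : Set ℝ} (hA : A.OrdConnected) {x y : ℝ} (hx : x ∈ A) (hy : y ∈ A)
    (hxy : y ≠ x) :
    ∃ ε₁ ε₂ : ℝ, 0 ≤ ε₁ ∧ 0 ≤ ε₂ ∧ 0 < ε₁ + ε₂ ∧ Set.Ioo (x - ε₁) (x + ε₂) ⊆ A := by
  rcases lt_or_gt_of_ne hxy with h | h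
  · refine ⟨x - y, 0, by linarith, le_rfl, by linarith, fun z hz => hA.out hy hx ?_⟩
    constructor <;> linarith [hz.1, hz.2]
  · refine ⟨0, y - x, le_rfl, by linarith, by linarith, fun z hz => hA.out hx hy ?_⟩
    constructor <;> linarith [hz.1, hz.2]

theorem accPt_of_Ioo_subset {A : Set ℝ} {x ε₁ ε₂ : ℝ} (h₁ : 0 ≤ ε₁) (h₂ : 0 ≤ ε₂)
    (h : 0 < ε₁ + ε₂) (hA : Set.Ioo (x - ε₁) (x + ε₂) ⊆ A) : AccPt x (𝓟 A) := by
  rw [accPt_iff_nhds]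
  intro U hU
  obtain ⟨r, hr, hrU⟩ := Metric.mem_nhds_iff.1 hU
  rcases h₂.lt_or_eq with h₂ | rfl
  · have hm : 0 < min r ε₂ := lt_min hr h₂
    have := min_le_left r ε₂
    have := min_le_right r ε₂
    refine ⟨x + min r ε₂ / 2, ⟨hrU ?_, hA ⟨by linarith, by linarith⟩⟩, by linarith⟩
    rw [Metric.mem_ball, Real.dist_eq, abs_lt]
    constructor <;> linarith
  · have hm : 0 < min r ε₁ := lt_min hr (by linarith)
    have := min_le_left r ε₁
    have := min_le_right r ε₁
    refine ⟨x - min r ε₁ / 2, ⟨hrU ?_, hA ⟨by linarith, by linarith⟩⟩, by linarith⟩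
    rw [Metric.mem_ball, Real.dist_eq, abs_lt]
    constructor <;> linarith

/-- The local inverse of `Φ`, restricted to the unit circle near `1`. -/
theorem exists_curve {Φ : ℂ → ℂ} {s₀ : ℂ} (hΦ : AnalyticAt ℂ Φ s₀) (h1 : Φ s₀ = 1)
    (hd : deriv Φ s₀ ≠ 0) :
    ∃ δ > 0, ∃ γ : ℝ → ℂ, γ 0 = s₀ ∧ ContinuousOn γ (Set.Ioo (-δ) δ) ∧
      ∀ τ ∈ Set.Ioo (-δ) δ, Φ (γ τ) = exp (I * τ) := by
  have hs : HasStrictDerivAt Φ (deriv Φ s₀) s₀ := hΦ.hasStrictDerivAt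
  set ψ := hs.localInverse Φ (deriv Φ s₀) s₀ hd
  have hψ : HasStrictDerivAt ψ (deriv Φ s₀)⁻¹ (Φ s₀) := hs.to_localInverse hd
  obtain ⟨K, V, hV, hK⟩ := HasStrictFDerivAt.exists_lipschitzOnWith hψ
  have hr : ∀ᶠ w in 𝓝 (Φ s₀), Φ (ψ w) = w := hs.eventually_right_inverse hd
  rw [h1] at hr hV
  have hcont : Continuous fun τ : ℝ => exp (I * τ) := by fun_prop
  have hE : Tendsto (fun τ : ℝ => exp (I * τ)) (𝓝 0) (𝓝 1) := by
    simpa using hcont.tendsto 0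
  obtain ⟨δ, hδ, hball⟩ := Metric.eventually_nhds_iff.1 ((hE.eventually hr).and (hE.eventually hV))
  have hball' : ∀ τ ∈ Set.Ioo (-δ) δ, Φ (ψ (exp (I * τ))) = exp (I * τ) ∧ exp (I * τ) ∈ V :=
    fun τ hτ => hball (by rw [Real.dist_0_eq_abs]; exact abs_lt.2 hτ)
  refine ⟨δ, hδ, fun τ => ψ (exp (I * τ)), ?_, ?_, fun τ hτ => (hball' τ hτ).1⟩
  · have : ψ (Φ s₀) = s₀ := (hs.eventually_left_inverse hd).self_of_nhds
    simpa [h1] using this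
  · exact hK.continuousOn.comp hcont.continuousOn fun τ hτ => (hball' τ hτ).2

theorem theorem26 (n : ℕ) (hn : 2 < n) (s₀ : ℂ) (hs₀ : analyticOrderAt (G n) s₀ = 1) :
    (∃ ε₁ ε₂ : ℝ, 0 ≤ ε₁ ∧ 0 ≤ ε₂ ∧ 0 < ε₁ + ε₂ ∧
      Set.Ioo (s₀.re - ε₁) (s₀.re + ε₂) ⊆ R n) ∧
    AccPt s₀.re (Filter.principal (R n)) := by
  -- Bertrand's postulate gives a prime with `n / 2 < p ≤ n`.
  obtain ⟨p, hp, hlt, hle⟩ := Nat.exists_prime_lt_and_le_two_mul (n / 2) (by omega)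
  have hpn : p ≤ n := by omega
  have hnp : n < 2 * p := by omega
  have hp0 : (p : ℂ) ≠ 0 := by exact_mod_cast hp.ne_zero
  have hG : AnalyticAt ℂ (G n) s₀ := by
    have := analyticOnNhd_sum_mul_natCast_cpow (Finset.Icc 1 n)
      (fun _ => ne_zero_of_mem_Icc_one) (fun _ => 1) s₀ (Set.mem_univ _)
    simp only [one_mul] at this
    exact this
  have hq : AnalyticAt ℂ (fun s : ℂ => (p : ℂ) ^ s) s₀ :=
    (differentiable_id.const_cpow (Or.inl hp0)).analyticAt s₀
  have hq0 : (p : ℂ) ^ s₀ ≠ 0 := by simp [cpow_eq_zero_iff, hp0]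
  have hG0 : G n s₀ = 0 := by
    by_contra hne
    rw [hG.analyticOrderAt_eq_zero.2 hne] at hs₀
    simp at hs₀
  obtain ⟨δ, hδ, γ, hγ0, hγc, hγ⟩ := exists_curve (Φ := fun s => 1 - G n s / (p : ℂ) ^ s)
    (analyticAt_const.sub (hG.div hq hq0)) (by simp [hG0])
    (deriv_ne_zero_of_simple_zero hG hq hq0 hs₀)
  have h0 : (0 : ℝ) ∈ Set.Ioo (-δ) δ := ⟨by linarith, hδ⟩
  set A : Set ℝ := (fun τ => (γ τ).re) '' Set.Ioo (-δ) δ with hAdef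
  have hAR : A ⊆ R n := by
    rintro _ ⟨τ, hτ, rfl⟩
    refine re_mem_R_of_norm_eq_one hp hpn hnp ?_
    rw [hγ τ hτ, norm_exp_I_mul_ofReal]
  have hAconn : A.OrdConnected :=
    (isPreconnected_Ioo.image _ (continuous_re.comp_continuousOn hγc)).ordConnected
  have hA0 : s₀.re ∈ A := ⟨0, h0, by simp [hγ0]⟩
  have hne : ∃ τ ∈ Set.Ioo (-δ) δ, (γ τ).re ≠ s₀.re := by
    by_contra! hcon
    -- On `(-1, 1)` the equation `exp (i τ) = 1` forces `τ = 0`, so the curve leaves `s₀`.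
    have hev : ∀ᶠ τ : ℝ in 𝓝[≠] 0, τ ∈ Set.Ioo (-δ) δ ∧ τ ∈ Set.Ioo (-1 : ℝ) 1 :=
      nhdsWithin_le_nhds 
        (inter_mem (Ioo_mem_nhds h0.1 h0.2) (Ioo_mem_nhds (by norm_num) (by norm_num)))
    have hform : ∀ τ ∈ Set.Ioo (-δ) δ, γ τ = (s₀.re : ℂ) + I * (γ τ).im := fun τ hτ => by
      rw [← hcon τ hτ, mul_comm, re_add_im]
    have htend : Tendsto (fun τ => (γ τ).im) (𝓝[≠] 0) (𝓝[≠] s₀.im) := by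
      refine tendsto_nhdsWithin_iff.2 ⟨?_, ?_⟩
      · have : ContinuousAt γ 0 := hγc.continuousAt (Ioo_mem_nhds h0.1 h0.2)
        have := (continuous_im.continuousAt.comp this).tendsto
        simp only [Function.comp_def, hγ0] at this
        exact this.mono_left nhdsWithin_le_nhds
      · filter_upwards [hev, self_mem_nhdsWithin] with τ ⟨hτ, hτ1⟩ hτ0 him
        have hγs : γ τ = s₀ := Complex.ext (hcon τ hτ) him
        have h1 := hγ τ hτ
        simp only [hγs, hG0, zero_div, sub_zero] at h1
        have hsin : Real.sin τ = 0 := by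
          have := congrArg Complex.im h1
          rw [mul_comm, exp_ofReal_mul_I_im] at this
          simpa using this.symm
        refine hτ0 ((Real.sin_eq_zero_iff_of_lt_of_lt ?_ ?_).1 hsin) <;>
          linarith [hτ1.1, hτ1.2, Real.pi_gt_three]
    refine not_frequently_norm_eq_one hn hp hpn s₀.re s₀.im (htend.frequently
      (Eventually.frequently ?_))
    filter_upwards [hev] with τ ⟨hτ, _⟩
    rw [← hform τ hτ, hγ τ hτ, norm_exp_I_mul_ofReal]
  obtain ⟨τ, hτ, hτne⟩ := hne
  obtain ⟨ε₁, ε₂, h₁, h₂, h, hsub⟩ := exists_Ioo_subset hAconn hA0 ⟨τ, hτ, rfl⟩ hτne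
  exact ⟨⟨ε₁, ε₂, h₁, h₂, h, hsub.trans hAR⟩, accPt_of_Ioo_subset h₁ h₂ h (hsub.trans hAR)⟩
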